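/- Let $q$ be a power of a prime and let $\mathcal H$ be the set of affine $\mathbb F_{q^2}$-points $(x,y)\in\mathbb F_{q^2}^2$ of the Hermitian curve $x^{q+1}=y^q+y$. A parabola is a curve $y=ax^2+bx+c$ with $a,b,c\in\mathbb F_{q^2}$ and $a\neq 0$. For a parabola $C$, its planar intersection with $\mathcal H$ is the number of points $(x,y)\in\mathbb F_{q^2}^2$ lying on both $\mathcal H$ and $C$, counted without multiplicity. For an integer $k\ge 0$ let $n_k$ be the number of parabolas whose planar intersection with $\mathcal H$ equals $k$. (1) If $q$ is odd, the planar intersection of $\mathcal H$ with any parabola lies in $\{0,1,q-1,q,q+1,2q-1,2q\}$, and $$n_0=q^2(q+1)\frac{q-1}{2},\qquad n_1=q^2(q+1)\frac{q(q-3)}{2},\qquad n_{q-1}=q^2(q+1)\frac{q(q-1)^2}{2},$$ $$n_q=q^2(q+1)(q^2-q+1),\qquad n_{q+1}=q^2(q+1)\frac{q(q-1)(q-3)}{2},$$ $$n_{2q-1}=q^2(q+1)\frac{q(q-1)}{2},\qquad n_{2q}=q^2(q+1)\frac{q-1}{2}.$$ (2) If $q$ is even, the planar intersection of $\mathcal H$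 with any parabola lies in $\{1,q-1,q+1,2q-1\}$. If moreover $q\neq 2$, then $$n_1=q^3(q+1)\left(\frac q2-1\right),\qquad n_{q-1}=q^3(q+1)(q-1)\frac q2,$$ $$n_{q+1}=q^3(q+1)(q-1)\left(\frac q2-1\right),\qquad n_{2q-1}=q^3(q+1)\frac q2.$$ If $q=2$, where $q-1=1$ and $2q-1=q+1=3$, then $n_1=n_3=24$. -/

import Mathlib

/-- The affine `F`-points of the Hermitian curve `x^(q+1) = y^q + y`. -/
def hermitianCurve (q : ℕ) (F : Type*) [Field F] : Set (F × F) :=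
  {P | P.1 ^ (q + 1) = P.2 ^ q + P.2}

/-- The affine `F`-points of the curve `y = a x^2 + b x + c`. -/
def parabola {F : Type*} [Field F] (a b c : F) : Set (F × F) :=
  {P | P.2 = a * P.1 ^ 2 + b * P.1 + c}

/-- A plane curve is a parabola if it is `y = a x^2 + b x + c` for some `a ≠ 0`, `b`, `c`. -/
def IsParabola {F : Type*} [Field F] (C : Set (F × F)) : Prop :=
  ∃ a b c : F, a ≠ 0 ∧ C = parabola a b c

/-- The number of affine points that lie on both curves, disregarding multiplicity. -/
noncomputable def planarIntersection {F : Type*} (X Y : Set (F × F)) : ℕ :=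
  (X ∩ Y).ncard

/-- The number of parabolas that meet the Hermitian curve in exactly `k` affine `F`-points. -/
noncomputable def numParabolas (q : ℕ) (F : Type*) [Field F] (k : ℕ) : ℕ :=
  {C : Set (F × F) | IsParabola C ∧ planarIntersection (hermitianCurve q F) C = k}.ncard

open Finset

/-! Let σ be the `q`-power map, an involution of F with fixed field of size q; write N(x) = x σ(x)
and Tr(x) = x + σ(x). Substituting the parabola into the curve gives N(x) = Tr(ax² + bx + c), that
is, Q_a(x) - Tr(bx) = Tr(c) with Q_a(x) = N(x) - Tr(ax²). This is an affine conic over the fixed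
field, and the discriminant of Q_a is 1 - 4N(a) up to sign.

If 1 - 4N(a) ≠ 0, a translation removes the linear term (`exists_abscissaCount_eq`), leaving Q_a(x)
= s. Let i be the number of isotropic directions u = σ(x)/x, which is 0 or 2. There are 1 + (q - 1)i
solutions for s = 0, and q + 1 - i for s ≠ 0 (`card_hermForm_eq`). For each b, s = 0 occurs for
exactly q values of c.

If 1 - 4N(a) = 0, which forces odd characteristic, Q_a is a multiple of the square of a linear form.
The conic then has q points when the linear term is independent of that form, and otherwise is made
of 0, 1 or 2 parallel lines of q points.

The numbers of leading coefficients of each type come from counting pairs (a, u) with u isotropic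
for Q_a (`sum_card_isoDirs`).

Exact counts are mostly obtained from upper bounds: if every fibre attains its bound on average, it
attains it everywhere (`card_fiber_eq_of_le`). -/

/-! ### Fibre counting, root bounds, and the `q`-power map -/

/-- If all fibres have at most `m` elements and the total is at least `m` per point of the target,
then all fibres have exactly `m` elements. -/
theorem card_fiber_eq_of_le {α β : Type*} [DecidableEq β] {S : Finset α} {T : Finset β}
    {f : α → β} {m : ℕ} (hf : ∀ x ∈ S, f x ∈ T) (hle : ∀ t ∈ T, #{x ∈ S | f x = t} ≤ m)
    (hcard : m * #T ≤ #S) : ∀ t ∈ T, #{x ∈ S | f x = t} = m := by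
  have h1 : ∑ t ∈ T, #{x ∈ S | f x = t} = ∑ t ∈ T, m := by
    apply le_antisymm (Finset.sum_le_sum hle)
    rw [← Finset.card_eq_sum_card_fiberwise hf, Finset.sum_const, smul_eq_mul, mul_comm]
    exact hcard
  exact (Finset.sum_eq_sum_iff_of_le hle).1 h1

theorem card_filter_pow_eq_le {F : Type*} [Field F] [Fintype F] [DecidableEq F] {n : ℕ}
    (hn : 0 < n) (c : F) : #{x : F | x ^ n = c} ≤ n := by
  calc #{x : F | x ^ n = c} ≤ #(Polynomial.nthRoots n c).toFinset := by
        apply Finset.card_le_card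
        intro x hx
        simpa [Polynomial.mem_nthRoots hn] using hx
    _ ≤ _ := (Multiset.toFinset_card_le _).trans (Polynomial.card_nthRoots n c)

/-- With n = q, the cases e = 1 and e = -1 bound the fibres of the trace and of σ(x) - x. -/
theorem card_filter_pow_add_mul_eq_le {F : Type*} [Field F] [Fintype F] [DecidableEq F] {n : ℕ}
    (hn : 2 ≤ n) (e c : F) : #{x : F | x ^ n + e * x = c} ≤ n := by
  let p : Polynomial F := Polynomial.X ^ n + (Polynomial.C e * Polynomial.X - Polynomial.C c)
  have hd : (Polynomial.C e * Polynomial.X - Polynomial.C c).degree < (n : WithBot ℕ) := by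
    have h1 : (Polynomial.C e * Polynomial.X - Polynomial.C c).degree ≤ 1 := by
      rw [sub_eq_add_neg, ← Polynomial.C_neg]
      exact Polynomial.degree_linear_le
    refine h1.trans_lt ?_
    exact_mod_cast hn
  have hm : p.Monic := Polynomial.monic_X_pow_add hd
  have hdeg : p.natDegree = n := by
    apply Polynomial.natDegree_eq_of_degree_eq_some
    rw [Polynomial.degree_add_eq_left_of_degree_lt] <;> simp [hd]
  calc #{x : F | x ^ n + e * x = c} ≤ #p.roots.toFinset := by
        apply Finset.card_le_card
        intro x hx
        have hx' : x ^ n + e * x = c := by simpa using hx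
        simp only [Multiset.mem_toFinset, Polynomial.mem_roots hm.ne_zero, p, Polynomial.IsRoot.def,
          Polynomial.eval_add, Polynomial.eval_sub, Polynomial.eval_pow, Polynomial.eval_X,
          Polynomial.eval_mul, Polynomial.eval_C]
        linear_combination hx'
    _ ≤ n := by
        rw [← hdeg]
        exact (Multiset.toFinset_card_le _).trans (Polynomial.card_roots' p)

/-- The `q`-power map of a field with `q ^ 2` elements is a ring homomorphism. -/
theorem exists_ringHom_eq_pow {q : ℕ} (hq : IsPrimePow q) {F : Type*} [Field F] [Finite F]
    (hF : Nat.card F = q ^ 2) : ∃ σ : F →+* F, ∀ x, σ x = x ^ q := by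
  obtain ⟨p, n, hp, hn, rfl⟩ := hq
  have hp' := hp.nat_prime
  have : Fact p.Prime := ⟨hp'⟩
  have : Fintype F := Fintype.ofFinite F
  obtain ⟨r, hr⟩ := CharP.exists F
  obtain ⟨m, hrp, hm⟩ := FiniteField.card F r
  have hrp' : r = p := by
    rw [Nat.card_eq_fintype_card, hm, ← pow_mul] at hF
    exact ((Nat.Prime.dvd_of_dvd_pow hrp (hF ▸ dvd_pow_self r m.ne_zero)) |>
      (Nat.prime_dvd_prime_iff_eq hrp hp').1)
  subst hrp'
  have : ExpChar F r := ExpChar.prime hrp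
  exact ⟨iterateFrobenius F r n, fun x => iterateFrobenius_def r n x⟩

/-! ### Norm, trace and Hilbert 90, in counted form -/

section QuadraticConjugation

variable {q : ℕ} {F : Type*} [Field F] [Fintype F] [DecidableEq F] {σ : F →+* F}

omit [DecidableEq F] in
theorem conj_conj (hF : Fintype.card F = q ^ 2) (hσ : ∀ x, σ x = x ^ q) (x : F) :
    σ (σ x) = x := by
  rw [hσ, hσ, ← pow_mul, ← sq, ← hF, FiniteField.pow_card]

/-- The norm sends q² - 1 = (q + 1)(q - 1) nonzero elements to nonzero fixed ones. Root bounds allow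
at most q + 1 elements per fibre and q - 1 targets, so both bounds are attained. -/
theorem card_filter_conj_eq_self_and_ne_zero (hq : 2 ≤ q) (hF : Fintype.card F = q ^ 2)
    (hσ : ∀ x, σ x = x ^ q) : #{x : F | σ x = x ∧ x ≠ 0} = q - 1 ∧
      ∀ t ∈ ({x : F | σ x = x ∧ x ≠ 0} : Finset F), #{x : F | x ≠ 0 ∧ x * σ x = t} = q + 1 := by
  have hle : #{x : F | σ x = x ∧ x ≠ 0} ≤ q - 1 := by
    refine le_trans (Finset.card_le_card ?_)
      (card_filter_pow_eq_le (F := F) (n := q - 1) (by omega) 1)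
    intro x hx
    simp only [mem_filter, mem_univ, true_and, hσ] at hx ⊢
    have h1 : x ^ (q - 1) * x = 1 * x := by
      rw [← pow_succ, Nat.sub_add_cancel (by omega), one_mul]; exact hx.1
    exact mul_right_cancel₀ hx.2 h1
  have hS : #{x : F | x ≠ 0} = q ^ 2 - 1 := by
    rw [Finset.filter_ne', Finset.card_erase_of_mem (mem_univ _), Finset.card_univ, hF]
  have hfib : ∀ t ∈ ({x : F | σ x = x ∧ x ≠ 0} : Finset F),
      #{x ∈ ({x : F | x ≠ 0} : Finset F) | x * σ x = t} ≤ q + 1 := by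
    intro t _
    refine le_trans (Finset.card_le_card ?_)
      (card_filter_pow_eq_le (F := F) (n := q + 1) (by omega) t)
    intro x hx
    simp only [mem_filter, mem_univ, true_and, hσ] at hx ⊢
    rw [pow_succ']; exact hx.2
  have hmap : ∀ x ∈ ({x : F | x ≠ 0} : Finset F),
      x * σ x ∈ ({x : F | σ x = x ∧ x ≠ 0} : Finset F) := by
    intro x hx
    simp only [mem_filter, mem_univ, true_and] at hx ⊢
    refine ⟨by rw [map_mul, conj_conj hF hσ, mul_comm], mul_ne_zero hx ?_⟩
    simpa using hx
  have hsq : q ^ 2 - 1 = (q + 1) * (q - 1) := by simpa using Nat.sq_sub_sq q 1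
  have hge : q - 1 ≤ #{x : F | σ x = x ∧ x ≠ 0} := by
    have h2 := Finset.card_eq_sum_card_fiberwise hmap
    have h3 := Finset.sum_le_card_nsmul _ _ _ hfib
    rw [← h2, hS, hsq, smul_eq_mul, mul_comm] at h3
    exact Nat.le_of_mul_le_mul_right h3 (by omega)
  have heq := le_antisymm hle hge
  refine ⟨heq, fun t ht => ?_⟩
  have := card_fiber_eq_of_le hmap hfib (by rw [heq, hS, hsq]) t ht
  rwa [Finset.filter_filter] at this

theorem card_filter_conj_eq_self (hq : 2 ≤ q) (hF : Fintype.card F = q ^ 2)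
    (hσ : ∀ x, σ x = x ^ q) : #{x : F | σ x = x} = q := by
  have h := (card_filter_conj_eq_self_and_ne_zero hq hF hσ).1
  rw [← Finset.filter_filter, Finset.filter_ne', Finset.card_erase_of_mem (by simp)] at h
  have h0 : 0 < #{x : F | σ x = x} := Finset.card_pos.2 ⟨0, by simp⟩
  omega

theorem card_filter_norm_eq_one (hq : 2 ≤ q) (hF : Fintype.card F = q ^ 2)
    (hσ : ∀ x, σ x = x ^ q) : #{u : F | u * σ u = 1} = q + 1 := by
  rw [← (card_filter_conj_eq_self_and_ne_zero hq hF hσ).2 1 (by simp)]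
  congr 1
  ext x
  simp only [mem_filter, mem_univ, true_and]
  refine ⟨fun h => ⟨?_, h⟩, fun h => h.2⟩
  rintro rfl
  simp at h

/-- Multiplicative Hilbert 90: x ↦ σ(x)/x has fibres of size at most q - 1 over the q + 1 elements
of norm one, which leaves no slack. -/
theorem card_filter_conj_eq_mul (hq : 2 ≤ q) (hF : Fintype.card F = q ^ 2)
    (hσ : ∀ x, σ x = x ^ q) {u : F} (hu : u * σ u = 1) :
    #{x : F | x ≠ 0 ∧ σ x = u * x} = q - 1 := by
  have hmap : ∀ x ∈ ({x : F | x ≠ 0} : Finset F),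
      σ x / x ∈ ({u : F | u * σ u = 1} : Finset F) := by
    intro x hx
    simp only [mem_filter, mem_univ, true_and] at hx ⊢
    have : σ x ≠ 0 := by simpa using hx
    rw [map_div₀, conj_conj hF hσ]
    field_simp
  have hfib : ∀ t ∈ ({u : F | u * σ u = 1} : Finset F),
      #{x ∈ ({x : F | x ≠ 0} : Finset F) | σ x / x = t} ≤ q - 1 := by
    intro t _
    refine le_trans (Finset.card_le_card ?_)
      (card_filter_pow_eq_le (F := F) (n := q - 1) (by omega) t)
    intro x hx
    simp only [mem_filter, mem_univ, true_and, hσ] at hx ⊢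
    rw [← hx.2, eq_div_iff hx.1, ← pow_succ, Nat.sub_add_cancel (by omega)]
  have hS : #{x : F | x ≠ 0} = q ^ 2 - 1 := by
    rw [Finset.filter_ne', Finset.card_erase_of_mem (mem_univ _), Finset.card_univ, hF]
  have hsq : q ^ 2 - 1 = (q + 1) * (q - 1) := by simpa using Nat.sq_sub_sq q 1
  have := card_fiber_eq_of_le hmap hfib
    (by rw [card_filter_norm_eq_one hq hF hσ, hS, hsq, mul_comm]) u (by simpa using hu)
  rw [← this, Finset.filter_filter]
  congr 1
  ext x
  simp only [mem_filter, mem_univ, true_and]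
  exact and_congr_right fun hx => (div_eq_iff hx).symm

theorem card_filter_add_conj_eq (hq : 2 ≤ q) (hF : Fintype.card F = q ^ 2)
    (hσ : ∀ x, σ x = x ^ q) {s : F} (hs : σ s = s) : #{x : F | x + σ x = s} = q := by
  refine card_fiber_eq_of_le (S := univ) (T := ({x : F | σ x = x} : Finset F)) ?_ ?_ ?_ s
    (by simpa using hs)
  · intro x _
    simp [conj_conj hF hσ, add_comm]
  · intro t _
    refine le_trans (Finset.card_le_card ?_) (card_filter_pow_add_mul_eq_le hq 1 t)
    intro x hx
    simp only [mem_filter, mem_univ, true_and, hσ] at hx ⊢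
    rw [← hx]; ring
  · rw [card_filter_conj_eq_self hq hF hσ, Finset.card_univ, hF, sq]

theorem card_filter_conj_eq_neg (hq : 2 ≤ q) (hF : Fintype.card F = q ^ 2)
    (hσ : ∀ x, σ x = x ^ q) : #{x : F | σ x = -x} = q := by
  rw [← card_filter_add_conj_eq hq hF hσ (map_zero σ)]
  congr 1
  ext x
  simp only [mem_filter, mem_univ, true_and]
  rw [add_comm, eq_neg_iff_add_eq_zero]

/-- Additive Hilbert 90, by the same saturation argument. -/
theorem card_filter_conj_sub_eq (hq : 2 ≤ q) (hF : Fintype.card F = q ^ 2)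
    (hσ : ∀ x, σ x = x ^ q) {z : F} (hz : σ z = -z) : #{x : F | σ x - x = z} = q := by
  refine card_fiber_eq_of_le (S := univ) (T := ({x : F | σ x = -x} : Finset F)) ?_ ?_ ?_ z
    (by simpa using hz)
  · intro x _
    simp [conj_conj hF hσ]
  · intro t _
    refine le_trans (Finset.card_le_card ?_) (card_filter_pow_add_mul_eq_le hq (-1) t)
    intro x hx
    simp only [mem_filter, mem_univ, true_and, hσ] at hx ⊢
    rw [← hx]; ring
  · rw [card_filter_conj_eq_neg hq hF hσ, Finset.card_univ, hF, sq]

end QuadraticConjugation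

/-! ### The quadratic form and nondegenerate conics -/

section HermForm

variable {q : ℕ} {F : Type*} [Field F] {σ : F →+* F}

/-- The quadratic form `N(x) - Tr(a x^2)` attached to a field involution `σ`. -/
def hermForm (σ : F →+* F) (a x : F) : F := x * σ x - a * x ^ 2 - σ a * σ x ^ 2

theorem hermForm_of_conj_eq_mul (a x u : F) (hx : σ x = u * x) :
    hermForm σ a x = -x ^ 2 * (σ a * u ^ 2 - u + a) := by
  rw [hermForm, hx]; ring

theorem conj_hermForm (hσσ : ∀ x, σ (σ x) = x) (a x : F) :
    σ (hermForm σ a x) = hermForm σ a x := by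
  simp only [hermForm, map_sub, map_mul, map_pow, hσσ]; ring

/-- The polar form is Tr(y(σ(x) - 2ax)), so x ↦ σ(x) - 2ax governs both centres and tangents. -/
theorem hermForm_add (hσσ : ∀ x, σ (σ x) = x) (a x y : F) :
    hermForm σ a (x + y) = hermForm σ a x + hermForm σ a y
      + (y * (σ x - 2 * a * x) + σ (y * (σ x - 2 * a * x))) := by
  simp only [hermForm, map_add, map_sub, map_mul, map_ofNat, hσσ]; ring

variable [Fintype F] [DecidableEq F]

/-- The isotropic directions `σ x / x` of `hermForm σ a`. -/
def isoDirs (σ : F →+* F) (a : F) : Finset F :=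
  {u | u * σ u = 1 ∧ σ a * u ^ 2 - u + a = 0}

theorem mem_isoDirs {a u : F} :
    u ∈ isoDirs σ a ↔ u * σ u = 1 ∧ σ a * u ^ 2 - u + a = 0 := by
  simp [isoDirs]

theorem isoDirs_zero : isoDirs σ (0 : F) = ∅ := by
  ext u
  simp only [mem_isoDirs, notMem_empty, iff_false, map_zero]
  rintro ⟨h1, h2⟩
  have : u = 0 := by linear_combination -h2
  simp [this] at h1

/-- If one root of σ(a)u² - u + a has norm one, so has the other. They coincide only when 2σ(a)u =
1, which forces 4N(a) = 1. -/
theorem card_isoDirs (hσσ : ∀ x, σ (σ x) = x) {a : F} (ha : 1 - 4 * (a * σ a) ≠ 0) :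
    #(isoDirs σ a) = 0 ∨ #(isoDirs σ a) = 2 := by
  rcases (isoDirs σ a).eq_empty_or_nonempty with h | ⟨u, hu⟩
  · left; simp [h]
  right
  have ha0 : a ≠ 0 := by rintro rfl; simp [isoDirs_zero] at hu
  have hsa : σ a ≠ 0 := by simpa using ha0
  obtain ⟨h1, h2⟩ := mem_isoDirs.1 hu
  have hu0 : u ≠ 0 := left_ne_zero_of_mul_eq_one h1
  have hne : u ≠ 1 / σ a - u := by
    intro h
    have h3 : 2 * (σ a * u) = 1 := by
      field_simp at h
      linear_combination h
    have h4 : 2 * (a * σ u) = 1 := by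
      have := congrArg σ h3
      simpa only [map_mul, map_ofNat, map_one, hσσ] using this
    apply ha
    linear_combination 4 * a * σ a * h1 - 2 * (σ a * u) * h4 - h3
  have hset : isoDirs σ a = {u, 1 / σ a - u} := by
    ext v
    rw [mem_isoDirs, mem_insert, mem_singleton]
    constructor
    · rintro ⟨-, hv⟩
      by_cases hvu : v = u
      · exact Or.inl hvu
      right
      have : (v - u) * (σ a * (v + u) - 1) = 0 := by linear_combination hv - h2
      have h5 := (mul_eq_zero.1 this).resolve_left (sub_ne_zero.2 hvu)
      field_simp
      linear_combination h5
    · rintro (rfl | rfl)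
      · exact ⟨h1, h2⟩
      -- The product of the roots is a/σ(a), which has norm one.
      · have h6 : 1 / σ a - u = a / (σ a * u) := by
          field_simp
          linear_combination -h2
        have hsu : σ u ≠ 0 := by simpa using hu0
        refine ⟨?_, ?_⟩
        · rw [h6, map_div₀, map_mul, hσσ]
          field_simp
          exact h1.symm
        · field_simp
          linear_combination σ a * h2
  rw [hset, card_pair hne]

theorem isoDirs_of_disc_eq_zero {a : F} (ha : 1 - 4 * (a * σ a) = 0) :
    isoDirs σ a = {2 * a} := by
  have ha0 : a ≠ 0 := by rintro rfl; simp at ha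
  ext u
  rw [mem_isoDirs, mem_singleton]
  constructor
  · rintro ⟨-, h⟩
    have : (u - 2 * a) ^ 2 = 0 := by linear_combination 4 * a * h + u ^ 2 * ha
    exact sub_eq_zero.1 (pow_eq_zero_iff two_ne_zero |>.1 this)
  · rintro rfl
    refine ⟨?_, ?_⟩
    · simp only [map_mul, map_ofNat]; linear_combination -ha
    · linear_combination -a * ha

/-- Double counting: for fixed u of norm one, multiplying the equation by σ(u) turns it into
Tr(aσ(u)) = 1, which has q solutions a. -/
theorem sum_card_isoDirs (hq : 2 ≤ q) (hF : Fintype.card F = q ^ 2) (hσ : ∀ x, σ x = x ^ q) :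
    ∑ a : F, #(isoDirs σ a) = (q + 1) * q := by
  have h1 : ∑ a : F, #(isoDirs σ a)
      = ∑ u ∈ ({u : F | u * σ u = 1} : Finset F), #{a : F | σ a * u ^ 2 - u + a = 0} := by
    simp only [isoDirs, Finset.card_filter, Finset.sum_filter]
    rw [Finset.sum_comm]
    refine Finset.sum_congr rfl fun u _ => ?_
    by_cases hu : u * σ u = 1 <;> simp [hu]
  rw [h1, ← card_filter_norm_eq_one hq hF hσ, ← smul_eq_mul, ← Finset.sum_const]
  refine Finset.sum_congr rfl fun u hu => ?_
  have hu : u * σ u = 1 := by simpa using hu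
  have hσσ := conj_conj hF hσ
  rw [← card_filter_add_conj_eq hq hF hσ (map_one σ)]
  apply Finset.card_nbij' (fun a => a * σ u) (fun a => a * u)
  · intro a ha
    simp only [coe_filter, mem_univ, true_and, Set.mem_ofPred_eq, map_mul, hσσ] at ha ⊢
    linear_combination σ u * ha + hu - σ a * u * hu
  · intro a ha
    simp only [coe_filter, mem_univ, true_and, Set.mem_ofPred_eq, map_mul] at ha ⊢
    linear_combination u * ha + σ a * u * hu
  · intro a _
    simp only
    linear_combination a * hu
  · intro a _
    simp only
    linear_combination a * hu

/-- The number of nonzero isotropic vectors is `q - 1` per isotropic direction. -/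
theorem card_hermForm_eq_zero (hq : 2 ≤ q) (hF : Fintype.card F = q ^ 2)
    (hσ : ∀ x, σ x = x ^ q) (a : F) :
    #{x : F | hermForm σ a x = 0} = 1 + (q - 1) * #(isoDirs σ a) := by
  have h0 : ({x : F | hermForm σ a x = 0} : Finset F)
      = insert 0 ({x : F | x ≠ 0 ∧ hermForm σ a x = 0} : Finset F) := by
    have hz : hermForm σ a 0 = 0 := by simp [hermForm]
    ext x
    simp only [mem_insert, mem_filter, mem_univ, true_and]
    by_cases hx : x = 0 <;> simp [hx, hz]
  rw [h0, card_insert_of_notMem (by simp), add_comm]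
  congr 1
  have hmap : ∀ x ∈ ({x : F | x ≠ 0 ∧ hermForm σ a x = 0} : Finset F), σ x / x ∈ isoDirs σ a := by
    intro x hx
    simp only [mem_filter, mem_univ, true_and] at hx
    obtain ⟨hx, h⟩ := hx
    have hs : σ x ≠ 0 := by simpa using hx
    rw [mem_isoDirs]
    refine ⟨by rw [map_div₀, conj_conj hF hσ]; field_simp, ?_⟩
    rw [hermForm_of_conj_eq_mul a x (σ x / x) (by field_simp)] at h
    simpa [hx] using h
  rw [Finset.card_eq_sum_card_fiberwise hmap, mul_comm, ← smul_eq_mul]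
  rw [Finset.sum_congr rfl (g := fun _ => q - 1), Finset.sum_const]
  intro u hu
  obtain ⟨h1, h2⟩ := mem_isoDirs.1 hu
  rw [← card_filter_conj_eq_mul hq hF hσ h1, Finset.filter_filter]
  congr 1
  ext x
  simp only [mem_filter, mem_univ, true_and]
  constructor
  · rintro ⟨⟨hx, -⟩, h⟩
    exact ⟨hx, (div_eq_iff hx).1 h⟩
  · rintro ⟨hx, h⟩
    exact ⟨⟨hx, by rw [hermForm_of_conj_eq_mul a x u h, h2, mul_zero]⟩, (div_eq_iff hx).2 h⟩

/-- Projecting from a point of a nondegenerate central conic bounds its number of points. -/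
theorem card_hermForm_eq_add_le (hq : 2 ≤ q) (hF : Fintype.card F = q ^ 2)
    (hσ : ∀ x, σ x = x ^ q) {a : F} (ha : 1 - 4 * (a * σ a) ≠ 0) {s : F} (hs : s ≠ 0) :
    #{x : F | hermForm σ a x = s} ≤ q + 1 - #(isoDirs σ a) := by
  have hσσ := conj_conj hF hσ
  rcases ({x : F | hermForm σ a x = s} : Finset F).eq_empty_or_nonempty with h | ⟨P, hP⟩
  · simp [h]
  have hPs : hermForm σ a P = s := by simpa using hP
  set w : F := σ P - 2 * a * P with hw
  have hsw : σ w = P - 2 * σ a * σ P := by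
    simp only [hw, map_sub, map_mul, map_ofNat, hσσ]
  -- This is σ(w)² times the isotropy polynomial at -w/σ(w). It shows both that w ≠ 0 and that the
  -- tangent direction at P is not isotropic.
  have key : a * σ w ^ 2 + w * σ w + σ a * w ^ 2 = (1 - 4 * (a * σ a)) * s := by
    rw [← hPs, hsw, hw, hermForm]; ring
  have hw0 : w ≠ 0 := by
    intro h
    rw [h] at key
    simp only [map_zero] at key
    exact mul_ne_zero ha hs (by rw [← key]; ring)
  have hsw0 : σ w ≠ 0 := by simpa using hw0
  have hexp : ∀ x, hermForm σ a x = s →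
      hermForm σ a (x - P) + ((x - P) * w + σ ((x - P) * w)) = 0 := by
    intro x hx
    have := hermForm_add hσσ a P (x - P)
    rw [add_sub_cancel, hx, hPs] at this
    linear_combination -this
  -- The tangent direction at P: for d ≠ 0, Tr(dw) = 0 exactly when σ(d)/d = t.
  let t : F := -w / σ w
  have ht : t ∈ (({u : F | u * σ u = 1} : Finset F) \ isoDirs σ a) := by
    rw [mem_sdiff, mem_isoDirs]
    refine ⟨?_, ?_⟩
    · simp only [mem_filter, mem_univ, true_and, t, map_div₀, map_neg, hσσ]
      field_simp
    · rintro ⟨-, h⟩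
      refine mul_ne_zero ha hs ?_
      rw [← key]
      simp only [t] at h
      field_simp at h
      linear_combination h
  have hcard : #((({u : F | u * σ u = 1} : Finset F) \ isoDirs σ a).erase t) + 1
      = q + 1 - #(isoDirs σ a) := by
    rw [card_erase_add_one ht, card_sdiff_of_subset, card_filter_norm_eq_one hq hF hσ]
    intro u hu
    simpa using (mem_isoDirs.1 hu).1
  rw [← hcard, ← card_erase_add_one hP]
  apply Nat.succ_le_succ
  -- A further point of the conic is determined by its direction from P, which is neither isotropic
  -- nor tangent.
  apply Finset.card_le_card_of_injOn (fun x => σ (x - P) / (x - P))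
  · intro x hx
    simp only [coe_erase, Set.mem_sdiff, mem_coe, mem_filter, mem_univ, true_and,
      Set.mem_singleton_iff] at hx
    have hd : x - P ≠ 0 := sub_ne_zero.2 hx.2
    have hsd : σ (x - P) ≠ 0 := (map_ne_zero σ).2 hd
    have he := hexp x hx.1
    simp only
    generalize x - P = d at *
    -- Along u the equation is a quadratic term plus dσ(w)(u - t). If u is isotropic or tangent, one
    -- term vanishes, hence the other does too; then t would be isotropic.
    have hiso : ∀ u, σ d = u * d → (u ∈ isoDirs σ a ∨ u = t) → False := by
      intro u hu h
      have hu1 : u * σ u = 1 := by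
        have h1 := congrArg σ hu
        rw [hσσ, map_mul, hu] at h1
        have : (u * σ u - 1) * d = 0 := by linear_combination -h1
        exact sub_eq_zero.1 ((mul_eq_zero.1 this).resolve_right hd)
      have hB : d * w + σ (d * w) = d * σ w * (u - t) := by
        simp only [map_mul, hu, t]; field_simp; ring
      have hQ := hermForm_of_conj_eq_mul a d u hu
      rw [hB, hQ] at he
      have hboth : σ a * u ^ 2 - u + a = 0 ∧ u = t := by
        rcases h with h | h
        · have h2 := (mem_isoDirs.1 h).2
          refine ⟨h2, ?_⟩
          rw [h2, mul_zero, zero_add] at he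
          exact sub_eq_zero.1 ((mul_eq_zero.1 he).resolve_left (mul_ne_zero hd hsw0))
        · refine ⟨?_, h⟩
          rw [h, sub_self, mul_zero, add_zero] at he
          rw [h]
          exact (mul_eq_zero.1 he).resolve_left (neg_ne_zero.2 (pow_ne_zero 2 hd))
      exact (mem_sdiff.1 ht).2 (hboth.2 ▸ mem_isoDirs.2 ⟨hu1, hboth.1⟩)
    rw [mem_coe, mem_erase, mem_sdiff]
    refine ⟨fun h => hiso _ (by field_simp) (Or.inr h), ?_,
      fun h => hiso _ (by field_simp) (Or.inl h)⟩
    simp only [mem_filter, mem_univ, true_and]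
    rw [map_div₀, hσσ]; field_simp
  · intro x hx y hy hxy
    simp only [coe_erase, Set.mem_sdiff, mem_coe, mem_filter, mem_univ, true_and,
      Set.mem_singleton_iff] at hx hy
    have hd : x - P ≠ 0 := sub_ne_zero.2 hx.2
    have he : y - P ≠ 0 := sub_ne_zero.2 hy.2
    have hx' := hexp x hx.1
    have hy' := hexp y hy.1
    suffices x - P = y - P by simpa using this
    simp only at hxy
    set d := x - P
    set e := y - P
    obtain ⟨u, hu⟩ : ∃ u, u = σ d / d := ⟨_, rfl⟩
    have hdu : σ d = u * d := by rw [hu]; field_simp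
    have heu : σ e = u * e := by rw [hu, hxy]; field_simp
    rw [hermForm_of_conj_eq_mul a d u hdu, map_mul, hdu] at hx'
    rw [hermForm_of_conj_eq_mul a e u heu, map_mul, heu] at hy'
    have hA : σ a * u ^ 2 - u + a ≠ 0 := by
      intro hA
      rw [hA, mul_zero, zero_add] at hx'
      have h1 : w + u * σ w = 0 := by
        refine (mul_eq_zero.1 (?_ : d * (w + u * σ w) = 0)).resolve_left hd
        linear_combination hx'
      have h2 : u = t := by
        simp only [t]; field_simp; linear_combination h1
      have h3 := mem_sdiff.1 ht
      rw [← h2] at h3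
      exact h3.2 (mem_isoDirs.2 ⟨by simpa using h3.1, hA⟩)
    have h4 : d * e * (σ a * u ^ 2 - u + a) * (d - e) = 0 := by
      linear_combination d * hy' - e * hx'
    have h5 := (mul_eq_zero.1 h4).resolve_left (mul_ne_zero (mul_ne_zero hd he) hA)
    exact sub_eq_zero.1 h5

/-- Point count of a nondegenerate central conic over the fixed field. -/
theorem card_hermForm_eq (hq : 2 ≤ q) (hF : Fintype.card F = q ^ 2)
    (hσ : ∀ x, σ x = x ^ q) {a : F} (ha : 1 - 4 * (a * σ a) ≠ 0) {s : F} (hs : s ≠ 0)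
    (hσs : σ s = s) : #{x : F | hermForm σ a x = s} = q + 1 - #(isoDirs σ a) := by
  have hσσ := conj_conj hF hσ
  have := card_fiber_eq_of_le (S := ({x : F | hermForm σ a x ≠ 0} : Finset F))
    (T := ({x : F | σ x = x ∧ x ≠ 0} : Finset F)) (f := hermForm σ a)
    (m := q + 1 - #(isoDirs σ a)) ?_ ?_ ?_ s (by simp [hσs, hs])
  · rw [← this, Finset.filter_filter]
    congr 1
    ext x
    simp only [mem_filter, mem_univ, true_and]
    exact ⟨fun h => ⟨h ▸ hs, h⟩, fun h => h.2⟩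
  · intro x hx
    simp only [mem_filter, mem_univ, true_and] at hx ⊢
    exact ⟨conj_hermForm hσσ a x, hx⟩
  · intro t ht
    refine le_trans (card_le_card ?_)
      (card_hermForm_eq_add_le hq hF hσ ha (by simp at ht; exact ht.2))
    rw [Finset.filter_filter]
    intro x hx
    simp only [mem_filter, mem_univ, true_and] at hx ⊢
    exact hx.2
  -- Saturation: q² - 1 - (q - 1)i = (q - 1)(q + 1 - i), so the vectors with nonzero value fill all
  -- q - 1 fibres.
  · rw [(card_filter_conj_eq_self_and_ne_zero hq hF hσ).1]
    have h1 := card_hermForm_eq_zero hq hF hσ a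
    have h2 := Finset.card_filter_add_card_filter_not (s := (univ : Finset F))
      (fun x => hermForm σ a x = 0)
    rw [card_univ, hF, h1] at h2
    have h3 : #{x : F | hermForm σ a x ≠ 0} + (1 + (q - 1) * #(isoDirs σ a)) = q ^ 2 := by
      rw [← h2]; exact add_comm _ _
    obtain ⟨m, rfl⟩ : ∃ m, q = m + 1 := ⟨q - 1, by omega⟩
    rcases card_isoDirs hσσ ha with h | h
    · rw [h] at h3 ⊢
      simp only [Nat.add_sub_cancel, Nat.sub_zero] at h3 ⊢
      nlinarith
    · rw [h] at h3 ⊢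
      simp only [Nat.add_sub_cancel] at h3 ⊢
      have : m + 1 + 1 - 2 = m := by omega
      rw [this]
      nlinarith

/-- The number of affine points common to the Hermitian curve and `y = a x^2 + b x + c`, counted
by abscissa. -/
def abscissaCount (σ : F →+* F) (a b c : F) : ℕ :=
  #{x : F | x * σ x = (a * x ^ 2 + b * x + c) + σ (a * x ^ 2 + b * x + c)}

/-- Completing the square. -/
theorem exists_abscissaCount_eq (hσσ : ∀ x, σ (σ x) = x) {a : F} (ha : 1 - 4 * (a * σ a) ≠ 0)
    (b : F) : ∃ e, σ e = e ∧ ∀ c,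
      abscissaCount σ a b c = #{x : F | hermForm σ a x = c + σ c + e} := by
  have hinj : Function.Injective (fun x : F => σ x - 2 * a * x) := by
    intro x y hxy
    simp only at hxy
    have h1 : σ (x - y) = 2 * a * (x - y) := by rw [map_sub]; linear_combination hxy
    have h2 := congrArg σ h1
    simp only [hσσ, map_mul, map_ofNat] at h2
    rw [h1] at h2
    have : (1 - 4 * (a * σ a)) * (x - y) = 0 := by linear_combination h2
    exact sub_eq_zero.1 ((mul_eq_zero.1 this).resolve_left ha)
  -- The centre z of the conic exists because an injective self-map of a finite set is surjective.
  obtain ⟨z, hz⟩ := (Finite.injective_iff_surjective.1 hinj) b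
  simp only at hz
  refine ⟨z * b + σ (z * b) - hermForm σ a z, ?_, fun c => ?_⟩
  · rw [map_sub, map_add, hσσ, conj_hermForm hσσ, add_comm (σ _)]
  have hsplit : ∀ x, hermForm σ a x
      = hermForm σ a z + hermForm σ a (x - z) + ((x - z) * b + σ ((x - z) * b)) := by
    intro x
    have := hermForm_add hσσ a z (x - z)
    rwa [add_sub_cancel, hz] at this
  have hiff : ∀ x, x * σ x = (a * x ^ 2 + b * x + c) + σ (a * x ^ 2 + b * x + c) ↔
      hermForm σ a (x - z) = c + σ c + (z * b + σ (z * b) - hermForm σ a z) := by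
    intro x
    have h1 := hsplit x
    rw [hermForm] at h1
    simp only [map_add, map_sub, map_mul, map_pow] at h1 ⊢
    constructor
    · intro h
      linear_combination h - h1
    · intro h
      linear_combination h + h1
  apply Finset.card_nbij' (fun x => x - z) (fun x => x + z)
  · intro x hx
    simpa only [coe_filter, mem_univ, true_and, Set.mem_ofPred_eq, hiff] using hx
  · intro x hx
    simpa only [coe_filter, mem_univ, true_and, Set.mem_ofPred_eq, hiff, add_sub_cancel_right]
      using hx
  · intro x _; simp
  · intro x _; simp

/-- The number of `c` for which the conic attached to `(a, b, c)` has exactly `k` points. -/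
theorem card_abscissaCount_eq (hq : 2 ≤ q) (hF : Fintype.card F = q ^ 2)
    (hσ : ∀ x, σ x = x ^ q) {a : F} (ha : 1 - 4 * (a * σ a) ≠ 0) (b : F) (k : ℕ) :
    #{c : F | abscissaCount σ a b c = k} =
      (if k = 1 + (q - 1) * #(isoDirs σ a) then q else 0)
      + (if k = q + 1 - #(isoDirs σ a) then q ^ 2 - q else 0) := by
  obtain ⟨e, he, h⟩ := exists_abscissaCount_eq (conj_conj hF hσ) ha b
  have hval : ∀ c, abscissaCount σ a b c = if c + σ c = -e then 1 + (q - 1) * #(isoDirs σ a)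
      else q + 1 - #(isoDirs σ a) := by
    intro c
    rw [h]
    split_ifs with hc
    · rw [hc, neg_add_cancel, card_hermForm_eq_zero hq hF hσ]
    · refine card_hermForm_eq hq hF hσ ha (fun h0 => hc (eq_neg_of_add_eq_zero_left h0)) ?_
      simp only [map_add, conj_conj hF hσ, he, add_comm]
  have hT : #{c : F | c + σ c = -e} = q :=
    card_filter_add_conj_eq hq hF hσ (by rw [map_neg, he])
  have hT' : #{c : F | ¬ c + σ c = -e} = q ^ 2 - q := by
    have h2 := Finset.card_filter_add_card_filter_not (s := (univ : Finset F))
      (fun c => c + σ c = -e)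
    rw [card_univ, hF, hT] at h2
    omega
  rw [← Finset.card_filter_add_card_filter_not (fun c => c + σ c = -e), Finset.filter_filter,
    Finset.filter_filter]
  congr 1
  · split_ifs with hk
    · rw [← hT]
      congr 1
      ext c
      simp only [mem_filter, mem_univ, true_and]
      exact ⟨fun h => h.2, fun h => ⟨by rw [hval, if_pos h, hk], h⟩⟩
    · rw [card_eq_zero, filter_eq_empty_iff]
      rintro c - ⟨h1, h2⟩
      rw [hval, if_pos h2] at h1
      exact hk h1.symm
  · split_ifs with hk
    · rw [← hT']
      congr 1
      ext c
      simp only [mem_filter, mem_univ, true_and]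
      exact ⟨fun h => h.2, fun h => ⟨by rw [hval, if_neg h, hk], h⟩⟩
    · rw [card_eq_zero, filter_eq_empty_iff]
      rintro c - ⟨h1, h2⟩
      rw [hval, if_neg h2] at h1
      exact hk h1.symm

end HermForm

/-! ### Degenerate forms: parallel lines -/

section Degenerate

variable {q : ℕ} {F : Type*} [Field F] {σ : F →+* F} [Fintype F] [DecidableEq F]

/-- The number of square roots of `v` of trace zero. -/
def skewRootCount (σ : F →+* F) (v : F) : ℕ := #{w : F | σ w = -w ∧ w ^ 2 = v}

theorem skewRootCount_zero : skewRootCount σ (0 : F) = 1 := by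
  rw [skewRootCount, card_eq_one]
  refine ⟨0, ?_⟩
  ext w
  simp only [mem_filter, mem_univ, true_and, mem_singleton]
  constructor
  · rintro ⟨-, h⟩; simpa using h
  · rintro rfl; simp

theorem skewRootCount_of_ne_zero (h2 : (2 : F) ≠ 0) {v : F} (hv : v ≠ 0) :
    skewRootCount σ v = 0 ∨ skewRootCount σ v = 2 := by
  rw [skewRootCount]
  rcases ({w : F | σ w = -w ∧ w ^ 2 = v} : Finset F).eq_empty_or_nonempty with h | ⟨w, hw⟩
  · left; simp [h]
  right
  obtain ⟨h3, h4⟩ : σ w = -w ∧ w ^ 2 = v := by simpa using hw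
  have hw0 : w ≠ 0 := by rintro rfl; exact hv (by rw [← h4]; ring)
  have hne : w ≠ -w := by
    intro h
    have : 2 * w = 0 := by linear_combination h
    exact mul_ne_zero h2 hw0 this
  have : ({w : F | σ w = -w ∧ w ^ 2 = v} : Finset F) = {w, -w} := by
    ext x
    simp only [mem_filter, mem_univ, true_and, mem_insert, mem_singleton]
    constructor
    · rintro ⟨-, hx⟩
      exact sq_eq_sq_iff_eq_or_eq_neg.1 (hx.trans h4.symm)
    · rintro (rfl | rfl)
      · exact ⟨h3, h4⟩
      · exact ⟨by rw [map_neg, h3], by rw [neg_sq, h4]⟩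
  rw [this, card_pair hne]

/-- Squaring maps the q trace-zero elements to fixed ones. With n_j fixed elements having j roots
and n_1 = 1, this gives n_0 + 1 + n_2 = q and 1 + 2n_2 = q. -/
theorem card_filter_skewRootCount (hq : 2 ≤ q) (hF : Fintype.card F = q ^ 2)
    (hσ : ∀ x, σ x = x ^ q) (h2 : (2 : F) ≠ 0) :
    2 * #{v : F | σ v = v ∧ skewRootCount σ v = 0} = q - 1 ∧
    #{v : F | σ v = v ∧ skewRootCount σ v = 1} = 1 ∧
    2 * #{v : F | σ v = v ∧ skewRootCount σ v = 2} = q - 1 := by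
  have h1 : #{v : F | σ v = v ∧ skewRootCount σ v = 1} = 1 := by
    rw [card_eq_one]
    refine ⟨0, ?_⟩
    ext v
    simp only [mem_filter, mem_univ, true_and, mem_singleton]
    constructor
    · rintro ⟨-, h⟩
      by_contra hv
      rcases skewRootCount_of_ne_zero (σ := σ) h2 hv with h' | h' <;> omega
    · rintro rfl; exact ⟨map_zero σ, skewRootCount_zero⟩
  have hmap : ∀ v ∈ ({v : F | σ v = v} : Finset F), skewRootCount σ v ∈ ({0, 1, 2} : Finset ℕ) := by
    intro v _
    by_cases hv : v = 0
    · simp [hv, skewRootCount_zero]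
    · rcases skewRootCount_of_ne_zero (σ := σ) h2 hv with h' | h' <;> simp [h']
  have hsum := Finset.card_eq_sum_card_fiberwise hmap
  have hroots : ∑ v ∈ ({v : F | σ v = v} : Finset F), skewRootCount σ v = q := by
    rw [← card_filter_conj_eq_neg hq hF hσ,
      Finset.card_eq_sum_card_fiberwise (f := fun w : F => w ^ 2)
      (t := ({v : F | σ v = v} : Finset F))]
    · simp only [skewRootCount, Finset.filter_filter]
    · intro w hw
      simp only [coe_filter, mem_univ, true_and, Set.mem_ofPred_eq] at hw ⊢
      rw [map_pow, hw, neg_sq]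
  rw [← Finset.sum_fiberwise_of_maps_to hmap] at hroots
  have hconst : ∀ j ∈ ({0, 1, 2} : Finset ℕ),
      ∑ v ∈ ({v : F | σ v = v} : Finset F) with skewRootCount σ v = j, skewRootCount σ v
        = #{v : F | σ v = v ∧ skewRootCount σ v = j} * j := by
    intro j _
    rw [Finset.filter_filter, ← smul_eq_mul]
    apply Finset.sum_eq_card_nsmul
    intro v hv
    simp only [mem_filter, mem_univ, true_and] at hv
    exact hv.2
  rw [Finset.sum_congr rfl hconst] at hroots
  simp only [Finset.filter_filter] at hsum
  rw [card_filter_conj_eq_self hq hF hσ] at hsum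
  simp only [mem_insert, mem_singleton, zero_ne_one, OfNat.zero_ne_ofNat, or_self,
    not_false_eq_true, sum_insert, OfNat.one_ne_ofNat, sum_singleton, h1] at hsum hroots
  omega

variable {κ β : F}

/-- On a level set y ↦ σ(y) - y takes trace-zero values and is injective, since Tr(β) ≠ 0. So each
of the q level sets has at most q of the q² elements. -/
theorem card_parallel_lines_of_trace_ne_zero (hq : 2 ≤ q) (hF : Fintype.card F = q ^ 2)
    (hσ : ∀ x, σ x = x ^ q) (hκ : σ κ = κ) (hβ : β + σ β ≠ 0) {t : F} (ht : σ t = t) :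
    #{y : F | κ * (σ y - y) ^ 2 - (β * y + σ (β * y)) = t} = q := by
  have hσσ := conj_conj hF hσ
  refine card_fiber_eq_of_le (S := univ) (T := ({v : F | σ v = v} : Finset F))
    (f := fun y => κ * (σ y - y) ^ 2 - (β * y + σ (β * y))) ?_ ?_ ?_ t (by simpa using ht)
  · intro y _
    simp only [mem_filter, mem_univ, true_and, map_sub, map_add, map_mul, map_pow, hσσ, hκ]
    ring
  · intro s _
    rw [← card_filter_conj_eq_neg hq hF hσ]
    apply Finset.card_le_card_of_injOn (fun y => σ y - y)
    · intro y _
      simp only [coe_filter, mem_univ, true_and, Set.mem_ofPred_eq, map_sub, hσσ]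
      ring
    · intro x hx y hy hxy
      simp only [coe_filter, mem_univ, true_and, Set.mem_ofPred_eq, map_mul] at hx hy hxy
      rw [hxy] at hx
      have : (β + σ β) * (x - y) = 0 := by
        linear_combination hy - hx - σ β * hxy
      exact sub_eq_zero.1 ((mul_eq_zero.1 this).resolve_left hβ)
  · rw [card_filter_conj_eq_self hq hF hσ, Finset.card_univ, hF, sq]

/-- Here Tr(βy) = -β(σ(y) - y), so the equation is κz² + βz = t in z = σ(y) - y. Completing the
square gives w² = β² + 4κt with w = 2κz + β, and each trace-zero root w yields a line of q points.
-/
theorem card_parallel_lines_of_trace_eq_zero (hq : 2 ≤ q) (hF : Fintype.card F = q ^ 2)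
    (hσ : ∀ x, σ x = x ^ q) (h2 : (2 : F) ≠ 0) (hκ0 : κ ≠ 0) (hκ : σ κ = κ) (hβ : β + σ β = 0)
    (t : F) :
    #{y : F | κ * (σ y - y) ^ 2 - (β * y + σ (β * y)) = t}
      = q * skewRootCount σ (β ^ 2 + 4 * κ * t) := by
  have hσσ := conj_conj hF hσ
  have hσβ : σ β = -β := by linear_combination hβ
  have h2κ : 2 * κ ≠ 0 := mul_ne_zero h2 hκ0
  have hmap : ∀ y ∈ ({y : F | κ * (σ y - y) ^ 2 - (β * y + σ (β * y)) = t} : Finset F),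
      2 * κ * (σ y - y) + β ∈ ({w : F | σ w = -w ∧ w ^ 2 = β ^ 2 + 4 * κ * t} : Finset F) := by
    intro y hy
    simp only [mem_filter, mem_univ, true_and, map_add, map_mul, map_sub, map_ofNat, hσσ, hκ,
      hσβ] at hy ⊢
    refine ⟨by ring, ?_⟩
    linear_combination 4 * κ * hy
  rw [Finset.card_eq_sum_card_fiberwise hmap, skewRootCount, mul_comm q]
  refine Finset.sum_const_nat fun w hw => ?_
  obtain ⟨hw1, hw2⟩ : σ w = -w ∧ w ^ 2 = β ^ 2 + 4 * κ * t := by simpa using hw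
  have hz : σ ((w - β) / (2 * κ)) = -((w - β) / (2 * κ)) := by
    rw [map_div₀, map_sub, map_mul, map_ofNat, hκ, hσβ, hw1]; ring
  rw [← card_filter_conj_sub_eq hq hF hσ hz, Finset.filter_filter]
  congr 1
  ext y
  simp only [mem_filter, mem_univ, true_and]
  rw [eq_div_iff h2κ]
  constructor
  · rintro ⟨-, h⟩
    linear_combination h
  · intro h
    refine ⟨?_, by linear_combination h⟩
    have h3 : 4 * κ * (κ * (σ y - y) ^ 2 - (β * y + σ (β * y)) - t) = 0 := by
      rw [map_mul, hσβ]
      have h4 : w = 2 * κ * (σ y - y) + β := by linear_combination -h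
      rw [h4] at hw2
      linear_combination hw2
    have h5 : (4 : F) ≠ 0 := by
      have : (4 : F) = 2 * 2 := by norm_num
      rw [this]; exact mul_ne_zero h2 h2
    exact sub_eq_zero.1 ((mul_eq_zero.1 h3).resolve_left (mul_ne_zero h5 hκ0))

/-- If `4 a^(q+1) = 1`, the form is a multiple of the square of a linear form. -/
theorem exists_abscissaCount_eq_parallel_lines (hq : 2 ≤ q) (hF : Fintype.card F = q ^ 2)
    (hσ : ∀ x, σ x = x ^ q) {a : F} (ha : 1 - 4 * (a * σ a) = 0) :
    ∃ r κ : F, r ≠ 0 ∧ κ ≠ 0 ∧ σ κ = κ ∧ ∀ b c, abscissaCount σ a b c =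
      #{y : F | κ * (σ y - y) ^ 2 - (b * r * y + σ (b * r * y)) = c + σ c} := by
  have hu : 2 * a * σ (2 * a) = 1 := by
    simp only [map_mul, map_ofNat]; linear_combination -ha
  -- As 2a has norm one, Hilbert 90 gives r with σ(r) = 2ar; substituting x = ry turns the form into
  -- -ar²(σ(y) - y)².
  have hpos : 0 < #{x : F | x ≠ 0 ∧ σ x = 2 * a * x} := by
    rw [card_filter_conj_eq_mul hq hF hσ hu]; omega
  obtain ⟨r, hr⟩ := Finset.card_pos.1 hpos
  obtain ⟨hr0, hr⟩ : r ≠ 0 ∧ σ r = 2 * a * r := by simpa using hr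
  have ha0 : a ≠ 0 := by rintro rfl; simp at ha
  refine ⟨r, -a * r ^ 2, hr0, mul_ne_zero (neg_ne_zero.2 ha0) (pow_ne_zero 2 hr0), ?_, ?_⟩
  · simp only [map_mul, map_neg, map_pow, hr]
    linear_combination a * r ^ 2 * ha
  intro b c
  have hiff : ∀ y, (r * y) * σ (r * y) = (a * (r * y) ^ 2 + b * (r * y) + c)
        + σ (a * (r * y) ^ 2 + b * (r * y) + c) ↔
      -a * r ^ 2 * (σ y - y) ^ 2 - (b * r * y + σ (b * r * y)) = c + σ c := by
    intro y
    simp only [map_add, map_mul, map_pow, hr]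
    constructor
    · intro h
      linear_combination h - a * r ^ 2 * σ y ^ 2 * ha
    · intro h
      linear_combination h + a * r ^ 2 * σ y ^ 2 * ha
  apply Finset.card_nbij' (fun x => x / r) (fun y => r * y)
  · intro x hx
    simp only [coe_filter, mem_univ, true_and, Set.mem_ofPred_eq] at hx ⊢
    rw [← hiff, mul_div_cancel₀ _ hr0]
    exact hx
  · intro y hy
    simp only [coe_filter, mem_univ, true_and, Set.mem_ofPred_eq] at hy ⊢
    exact (hiff y).2 hy
  · intro x _
    exact mul_div_cancel₀ _ hr0
  · intro y _
    exact mul_div_cancel_left₀ _ hr0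

/-- As c varies, β² + 4κTr(c) takes each fixed value exactly q times. The factor 2 avoids halving q
- 1 in ℕ. -/
theorem card_filter_skewRootCount_trace (hq : 2 ≤ q) (hF : Fintype.card F = q ^ 2)
    (hσ : ∀ x, σ x = x ^ q) (h2 : (2 : F) ≠ 0) (hκ0 : κ ≠ 0) (hκ : σ κ = κ) (hβ : β + σ β = 0)
    (k : ℕ) :
    2 * #{c : F | q * skewRootCount σ (β ^ 2 + 4 * κ * (c + σ c)) = k} =
      (if k = q then 2 * q else 0) + (if k = 0 then q * (q - 1) else 0)
        + (if k = 2 * q then q * (q - 1) else 0) := by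
  have hσσ := conj_conj hF hσ
  have hσβ : σ β = -β := by linear_combination hβ
  have h4 : (4 : F) ≠ 0 := by
    have : (4 : F) = 2 * 2 := by norm_num
    rw [this]; exact mul_ne_zero h2 h2
  have h4κ : 4 * κ ≠ 0 := mul_ne_zero h4 hκ0
  have hmap : ∀ c ∈ ({c : F | q * skewRootCount σ (β ^ 2 + 4 * κ * (c + σ c)) = k} : Finset F),
      β ^ 2 + 4 * κ * (c + σ c)
        ∈ ({v : F | σ v = v ∧ q * skewRootCount σ v = k} : Finset F) := by
    intro c hc
    simp only [mem_filter, mem_univ, true_and] at hc ⊢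
    refine ⟨?_, hc⟩
    simp only [map_add, map_mul, map_pow, map_ofNat, hσσ, hκ, hσβ]
    ring
  have hcount : #{c : F | q * skewRootCount σ (β ^ 2 + 4 * κ * (c + σ c)) = k}
      = #{v : F | σ v = v ∧ q * skewRootCount σ v = k} * q := by
    rw [Finset.card_eq_sum_card_fiberwise hmap]
    refine Finset.sum_const_nat fun v hv => ?_
    obtain ⟨hv1, hv2⟩ : σ v = v ∧ q * skewRootCount σ v = k := by simpa using hv
    have hs : σ ((v - β ^ 2) / (4 * κ)) = (v - β ^ 2) / (4 * κ) := by
      rw [map_div₀, map_sub, map_mul, map_pow, map_ofNat, hκ, hσβ, hv1, neg_sq]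
    rw [Finset.filter_filter]
    refine Eq.trans ?_ (card_filter_add_conj_eq hq hF hσ hs)
    congr 1
    ext c
    simp only [mem_filter, mem_univ, true_and]
    rw [eq_div_iff h4κ]
    constructor
    · rintro ⟨-, h⟩
      linear_combination h
    · intro h
      have h' : β ^ 2 + 4 * κ * (c + σ c) = v := by linear_combination h
      exact ⟨by rw [h', hv2], h'⟩
  obtain ⟨c0, c1, c2⟩ := card_filter_skewRootCount hq hF hσ h2
  have hval : ∀ v : F,
      skewRootCount σ v = 0 ∨ skewRootCount σ v = 1 ∨ skewRootCount σ v = 2 := by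
    intro v
    by_cases hv : v = 0
    · simp [hv, skewRootCount_zero]
    · rcases skewRootCount_of_ne_zero (σ := σ) h2 hv with h' | h' <;> simp [h']
  have hj : ∀ j : ℕ, k = q * j → #{v : F | σ v = v ∧ q * skewRootCount σ v = k}
      = #{v : F | σ v = v ∧ skewRootCount σ v = j} := by
    intro j hk
    congr 1
    ext v
    simp only [mem_filter, mem_univ, true_and, hk]
    rw [Nat.mul_right_inj (by omega)]
  rw [hcount]
  by_cases hk0 : k = 0
  · rw [hj 0 (by omega), if_neg (by omega), if_pos hk0, if_neg (by omega), ← mul_assoc, c0]; ring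
  by_cases hk1 : k = q
  · rw [hj 1 (by omega), if_pos hk1, if_neg hk0, if_neg (by omega), c1]; ring
  by_cases hk2 : k = 2 * q
  · rw [hj 2 (by omega), if_neg hk1, if_neg hk0, if_pos hk2, ← mul_assoc, c2]; ring
  have hempty : ({v : F | σ v = v ∧ q * skewRootCount σ v = k} : Finset F) = ∅ := by
    rw [filter_eq_empty_iff]
    rintro v - ⟨-, h⟩
    rcases hval v with h' | h' | h' <;> rw [h'] at h <;> omega
  simp [hempty, hk0, hk1, hk2]

theorem abscissaCount_mem_of_disc_eq_zero (hq : 2 ≤ q) (hF : Fintype.card F = q ^ 2)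
    (hσ : ∀ x, σ x = x ^ q) {a : F} (ha : 1 - 4 * (a * σ a) = 0) (b c : F) :
    abscissaCount σ a b c = 0 ∨ abscissaCount σ a b c = q ∨ abscissaCount σ a b c = 2 * q := by
  have h2 : (2 : F) ≠ 0 := by
    intro h
    have h4 : (4 : F) = 0 := by linear_combination 2 * h
    simp [h4] at ha
  obtain ⟨r, κ, hr, hκ0, hκ, h⟩ := exists_abscissaCount_eq_parallel_lines hq hF hσ ha
  rw [h]
  by_cases hb : b * r + σ (b * r) = 0
  · rw [card_parallel_lines_of_trace_eq_zero hq hF hσ h2 hκ0 hκ hb]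
    by_cases hv : (b * r) ^ 2 + 4 * κ * (c + σ c) = 0
    · simp [hv, skewRootCount_zero]
    · rcases skewRootCount_of_ne_zero (σ := σ) h2 hv with h' | h' <;> simp [h', mul_comm q]
  · right; left
    exact card_parallel_lines_of_trace_ne_zero hq hF hσ hκ hb
      (by rw [map_add, conj_conj hF hσ, add_comm])

/-- The q values of b with Tr(br) = 0 give parallel lines; for the other q² - q, all q² values of c
give count q. -/
theorem sum_card_abscissaCount_eq_of_disc_eq_zero (hq : 2 ≤ q) (hF : Fintype.card F = q ^ 2)
    (hσ : ∀ x, σ x = x ^ q) {a : F} (ha : 1 - 4 * (a * σ a) = 0) (k : ℕ) :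
    2 * ∑ b : F, #{c : F | abscissaCount σ a b c = k} =
      (if k = q then 2 * q ^ 2 * (q ^ 2 - q + 1) else 0)
        + (if k = 0 then q ^ 2 * (q - 1) else 0)
        + (if k = 2 * q then q ^ 2 * (q - 1) else 0) := by
  have h2 : (2 : F) ≠ 0 := by
    intro h
    have h4 : (4 : F) = 0 := by linear_combination 2 * h
    simp [h4] at ha
  obtain ⟨r, κ, hr, hκ0, hκ, h⟩ := exists_abscissaCount_eq_parallel_lines hq hF hσ ha
  have hB : #{b : F | b * r + σ (b * r) = 0} = q := by
    rw [← card_filter_add_conj_eq hq hF hσ (map_zero σ)]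
    apply Finset.card_nbij' (fun b => b * r) (fun b => b / r)
    · intro b hb
      simpa using hb
    · intro b hb
      simp only [coe_filter, mem_univ, true_and, Set.mem_ofPred_eq] at hb ⊢
      rwa [div_mul_cancel₀ _ hr]
    · intro b _
      exact mul_div_cancel_right₀ _ hr
    · intro b _
      exact div_mul_cancel₀ _ hr
  have hB' : #{b : F | ¬ b * r + σ (b * r) = 0} = q ^ 2 - q := by
    have h3 := Finset.card_filter_add_card_filter_not (s := (univ : Finset F))
      (fun b => b * r + σ (b * r) = 0)
    rw [card_univ, hF, hB] at h3
    omega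
  rw [Finset.mul_sum, ← Finset.sum_filter_add_sum_filter_not _ (fun b => b * r + σ (b * r) = 0)]
  rw [Finset.sum_eq_card_nsmul (s := ({b : F | b * r + σ (b * r) = 0} : Finset F))
      (b := (if k = q then 2 * q else 0) + (if k = 0 then q * (q - 1) else 0)
        + (if k = 2 * q then q * (q - 1) else 0)),
    Finset.sum_eq_card_nsmul (s := ({b : F | ¬ b * r + σ (b * r) = 0} : Finset F))
      (b := if k = q then 2 * q ^ 2 else 0), hB, hB']
  · simp only [smul_eq_mul]
    split_ifs <;> ring
  · intro b hb
    have hb : ¬ b * r + σ (b * r) = 0 := by simpa using hb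
    have hc : ∀ c, abscissaCount σ a b c = q := fun c => by
      rw [h, card_parallel_lines_of_trace_ne_zero hq hF hσ hκ hb
        (by rw [map_add, conj_conj hF hσ, add_comm])]
    simp only [hc]
    by_cases hk : k = q
    · simp [hk, hF]
    · simp [hk, Ne.symm hk]
  · intro b hb
    have hb : b * r + σ (b * r) = 0 := by simpa using hb
    simp only [h, card_parallel_lines_of_trace_eq_zero hq hF hσ h2 hκ0 hκ hb]
    exact card_filter_skewRootCount_trace hq hF hσ h2 hκ0 hκ hb k

end Degenerate

/-! ### From coefficient triples to parabolas -/

section Parabolas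

variable {q : ℕ} {F : Type*} [Field F] {σ : F →+* F} [Fintype F] [DecidableEq F]

theorem planarIntersection_parabola (hσ : ∀ x, σ x = x ^ q)
    (a b c : F) :
    planarIntersection (hermitianCurve q F) (parabola a b c) = abscissaCount σ a b c := by
  have hset : hermitianCurve q F ∩ parabola a b c = (fun x : F => (x, a * x ^ 2 + b * x + c)) ''
      (({x : F | x * σ x = (a * x ^ 2 + b * x + c) + σ (a * x ^ 2 + b * x + c)} : Finset F)
        : Set F) := by
    ext ⟨x, y⟩
    simp only [hermitianCurve, parabola, Set.mem_inter_iff, Set.mem_ofPred_eq, coe_filter,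
      mem_univ, true_and, Set.mem_image, Prod.mk.injEq, hσ]
    constructor
    · rintro ⟨h1, rfl⟩
      exact ⟨x, by rw [← pow_succ', h1, add_comm], rfl, rfl⟩
    · rintro ⟨x, h, rfl, rfl⟩
      exact ⟨by rw [pow_succ', h, add_comm], rfl⟩
  rw [planarIntersection, hset, Set.ncard_image_of_injective _ (fun x y h => (Prod.ext_iff.1 h).1),
    Set.ncard_coe_finset, abscissaCount]

omit [DecidableEq F] in
-- Evaluation at 0, 1 and a third element recovers the coefficients; over two elements x² = x would
-- break this.
theorem parabola_injective (hF : 3 ≤ Fintype.card F) :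
    Function.Injective (fun p : F × F × F => parabola p.1 p.2.1 p.2.2) := by
  classical
  rintro ⟨a, b, c⟩ ⟨a', b', c'⟩ h
  simp only at h
  have hx : ∀ x : F, a * x ^ 2 + b * x + c = a' * x ^ 2 + b' * x + c' := by
    intro x
    have h1 : (x, a * x ^ 2 + b * x + c) ∈ parabola a b c := rfl
    rw [h] at h1
    exact h1
  obtain ⟨x, hx01⟩ : ∃ x : F, x ∉ ({0, 1} : Finset F) := by
    by_contra! hall
    have h1 : Fintype.card F ≤ #({0, 1} : Finset F) := by
      rw [← Finset.card_univ]; exact Finset.card_le_card fun x _ => hall x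
    have := Finset.card_le_two (a := (0 : F)) (b := 1)
    omega
  simp only [mem_insert, mem_singleton, not_or] at hx01
  have hc : c = c' := by simpa using hx 0
  have h1 : a + b + c = a' + b' + c' := by simpa using hx 1
  have h2 : x * (x - 1) * (a - a') = 0 := by
    linear_combination hx x - x * h1 + (x - 1) * hc
  have ha := sub_eq_zero.1 ((mul_eq_zero.1 h2).resolve_left
    (mul_ne_zero hx01.1 (sub_ne_zero.2 hx01.2)))
  have hb : b = b' := by linear_combination h1 - ha - hc
  rw [ha, hb, hc]

theorem numParabolas_eq_sum (hq : 2 ≤ q) (hF : Fintype.card F = q ^ 2) (hσ : ∀ x, σ x = x ^ q)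
    (k : ℕ) : numParabolas q F k =
      ∑ a ∈ ({a : F | a ≠ 0} : Finset F), ∑ b : F, #{c : F | abscissaCount σ a b c = k} := by
  have hset : {C : Set (F × F) | IsParabola C ∧ planarIntersection (hermitianCurve q F) C = k} =
      (fun p : F × F × F => parabola p.1 p.2.1 p.2.2) ''
        (({p : F × F × F | p.1 ≠ 0 ∧ abscissaCount σ p.1 p.2.1 p.2.2 = k} : Finset (F × F × F))
          : Set (F × F × F)) := by
    ext C
    simp only [IsParabola, Set.mem_ofPred_eq, coe_filter, mem_univ, true_and, Set.mem_image]
    constructor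
    · rintro ⟨⟨a, b, c, ha, rfl⟩, h⟩
      rw [planarIntersection_parabola hσ] at h
      exact ⟨(a, b, c), ⟨ha, h⟩, rfl⟩
    · rintro ⟨⟨a, b, c⟩, ⟨ha, h⟩, rfl⟩
      exact ⟨⟨a, b, c, ha, rfl⟩, by rw [planarIntersection_parabola hσ, h]⟩
  rw [numParabolas, hset, Set.ncard_image_of_injective _ (parabola_injective (by nlinarith)),
    Set.ncard_coe_finset, Finset.card_filter, Fintype.sum_prod_type, Finset.sum_filter]
  refine Finset.sum_congr rfl fun a _ => ?_
  rw [Fintype.sum_prod_type]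
  split_ifs with ha
  · simp only [ha, ne_eq, not_false_eq_true, true_and, Finset.card_filter]
  · simp [not_not.1 ha]

/-- The leading coefficients of degenerate forms. -/
theorem card_filter_disc_eq_zero (hq : 2 ≤ q) (hF : Fintype.card F = q ^ 2)
    (hσ : ∀ x, σ x = x ^ q) (h2 : (2 : F) ≠ 0) : #{a : F | 1 - 4 * (a * σ a) = 0} = q + 1 := by
  rw [← card_filter_norm_eq_one hq hF hσ]
  apply Finset.card_nbij' (fun a => 2 * a) (fun u => u / 2)
  · intro a ha
    simp only [coe_filter, mem_univ, true_and, Set.mem_ofPred_eq, map_mul, map_ofNat] at ha ⊢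
    linear_combination -ha
  · intro u hu
    simp only [coe_filter, mem_univ, true_and, Set.mem_ofPred_eq, map_div₀, map_ofNat] at hu ⊢
    field_simp
    linear_combination -4 * hu
  · intro a _
    exact mul_div_cancel_left₀ _ h2
  · intro u _
    exact mul_div_cancel₀ _ h2

/-- Two linear equations for the class sizes: the partition of F, where the final 1 is a = 0, and
the count of pairs (a, u), where a degenerate a has the single direction 2a. -/
theorem card_leading_coeff_classes (hq : 2 ≤ q) (hF : Fintype.card F = q ^ 2)
    (hσ : ∀ x, σ x = x ^ q) :
    #{a : F | a ≠ 0 ∧ 1 - 4 * (a * σ a) ≠ 0 ∧ #(isoDirs σ a) = 0}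
      + #{a : F | 1 - 4 * (a * σ a) ≠ 0 ∧ #(isoDirs σ a) = 2}
      + #{a : F | 1 - 4 * (a * σ a) = 0} + 1 = q ^ 2 ∧
    2 * #{a : F | 1 - 4 * (a * σ a) ≠ 0 ∧ #(isoDirs σ a) = 2}
      + #{a : F | 1 - 4 * (a * σ a) = 0} = (q + 1) * q := by
  have hσσ := conj_conj hF hσ
  constructor
  · have h1 : #{a : F | a = 0} = 1 := by
      rw [Finset.filter_eq', if_pos (mem_univ _), card_singleton]
    have huniv : #(univ : Finset F) = ∑ _a : F, 1 := Finset.card_eq_sum_ones _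
    rw [← hF, ← Finset.card_univ, huniv, ← h1]
    simp only [Finset.card_filter _ (univ : Finset F), ← Finset.sum_add_distrib]
    refine Finset.sum_congr rfl fun a _ => ?_
    by_cases ha0 : a = 0
    · simp [ha0, isoDirs_zero]
    by_cases ha : 1 - 4 * (a * σ a) = 0
    · simp [ha0, ha]
    rcases card_isoDirs hσσ ha with h | h <;> simp [ha0, ha, h]
  · rw [← sum_card_isoDirs hq hF hσ]
    simp only [Finset.card_filter, ← Finset.sum_add_distrib, Finset.mul_sum]
    refine Finset.sum_congr rfl fun a _ => ?_
    by_cases ha : 1 - 4 * (a * σ a) = 0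
    · simp [ha, isoDirs_of_disc_eq_zero ha]
    rcases card_isoDirs hσσ ha with h | h <;> simp [ha, h]

theorem two_mul_numParabolas (hq : 2 ≤ q) (hF : Fintype.card F = q ^ 2)
    (hσ : ∀ x, σ x = x ^ q) (k : ℕ) :
    2 * numParabolas q F k =
      #{a : F | a ≠ 0 ∧ 1 - 4 * (a * σ a) ≠ 0 ∧ #(isoDirs σ a) = 0} * (2 * q ^ 2 *
        ((if k = 1 then q else 0) + (if k = q + 1 then q ^ 2 - q else 0)))
      + #{a : F | 1 - 4 * (a * σ a) ≠ 0 ∧ #(isoDirs σ a) = 2} * (2 * q ^ 2 *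
        ((if k = 2 * q - 1 then q else 0) + (if k = q - 1 then q ^ 2 - q else 0)))
      + #{a : F | 1 - 4 * (a * σ a) = 0} * (
        (if k = q then 2 * q ^ 2 * (q ^ 2 - q + 1) else 0)
        + (if k = 0 then q ^ 2 * (q - 1) else 0)
        + (if k = 2 * q then q ^ 2 * (q - 1) else 0)) := by
  have hσσ := conj_conj hF hσ
  rw [numParabolas_eq_sum hq hF hσ, Finset.sum_filter, Finset.mul_sum]
  simp only [Finset.card_filter _ (univ : Finset F), Finset.sum_mul, ← Finset.sum_add_distrib]
  refine Finset.sum_congr rfl fun a _ => ?_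
  simp only [← Finset.card_filter _ (univ : Finset F)]
  by_cases ha : 1 - 4 * (a * σ a) = 0
  · have ha0 : a ≠ 0 := by rintro rfl; simp at ha
    rw [if_pos ha0, sum_card_abscissaCount_eq_of_disc_eq_zero hq hF hσ ha]
    simp [ha]
  by_cases ha0 : a = 0
  · simp [ha0, isoDirs_zero]
  rw [if_pos ha0]
  simp only [card_abscissaCount_eq hq hF hσ ha, Finset.sum_const, card_univ, hF, smul_eq_mul]
  rcases card_isoDirs hσσ ha with h | h
  · simp only [ha0, ha, h, ne_eq, not_false_eq_true, true_and, if_true, if_false, mul_zero,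
      add_zero, Nat.sub_zero, one_mul, zero_mul, OfNat.zero_ne_ofNat]
    ring
  · have h1 : 1 + (q - 1) * 2 = 2 * q - 1 := by omega
    have h2 : q + 1 - 2 = q - 1 := by omega
    simp only [ha0, ha, h, ne_eq, not_false_eq_true, true_and, if_true, if_false, h1, h2,
      add_zero, one_mul, zero_mul, zero_add, OfNat.ofNat_ne_zero]
    ring

/-- For any other value, `card_abscissaCount_eq` would give no constant term attaining it, yet c
does. -/
theorem abscissaCount_mem_of_disc_ne_zero (hq : 2 ≤ q) (hF : Fintype.card F = q ^ 2)
    (hσ : ∀ x, σ x = x ^ q) {a : F} (ha : 1 - 4 * (a * σ a) ≠ 0) (b c : F) :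
    abscissaCount σ a b c ∈ ({1, q - 1, q + 1, 2 * q - 1} : Set ℕ) := by
  by_contra hk
  have h := card_abscissaCount_eq hq hF hσ ha b (abscissaCount σ a b c)
  have hpos : 0 < #{c' : F | abscissaCount σ a b c' = abscissaCount σ a b c} :=
    Finset.card_pos.2 ⟨c, by simp⟩
  simp only [Set.mem_insert_iff, Set.mem_singleton_iff, not_or] at hk
  rcases card_isoDirs (conj_conj hF hσ) ha with h' | h' <;> rw [h'] at h
  · rw [if_neg (by omega), if_neg (by omega)] at h
    omega
  · rw [if_neg (by omega), if_neg (by omega)] at h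
    omega

end Parabolas

/-! ### The theorem: odd and even `q` -/

theorem theorem3p1 (q : ℕ) (hq : IsPrimePow q) (F : Type*) [Field F] [Finite F]
    (hF : Nat.card F = q ^ 2) :
    (Odd q →
      (∀ C : Set (F × F), IsParabola C →
        planarIntersection (hermitianCurve q F) C ∈
          ({0, 1, q - 1, q, q + 1, 2 * q - 1, 2 * q} : Set ℕ)) ∧
      (numParabolas q F 0 : ℚ) = q ^ 2 * (q + 1) * ((q - 1) / 2) ∧
      (numParabolas q F 1 : ℚ) = q ^ 2 * (q + 1) * (q * (q - 3) / 2) ∧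
      (numParabolas q F (q - 1) : ℚ) = q ^ 2 * (q + 1) * (q * (q - 1) ^ 2 / 2) ∧
      (numParabolas q F q : ℚ) = q ^ 2 * (q + 1) * (q ^ 2 - q + 1) ∧
      (numParabolas q F (q + 1) : ℚ) = q ^ 2 * (q + 1) * (q * (q - 1) * (q - 3) / 2) ∧
      (numParabolas q F (2 * q - 1) : ℚ) = q ^ 2 * (q + 1) * (q * (q - 1) / 2) ∧
      (numParabolas q F (2 * q) : ℚ) = q ^ 2 * (q + 1) * ((q - 1) / 2)) ∧
    (Even q →
      (∀ C : Set (F × F), IsParabola C →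
        planarIntersection (hermitianCurve q F) C ∈
          ({1, q - 1, q + 1, 2 * q - 1} : Set ℕ)) ∧
      (q ≠ 2 →
        (numParabolas q F 1 : ℚ) = q ^ 3 * (q + 1) * (q / 2 - 1) ∧
        (numParabolas q F (q - 1) : ℚ) = q ^ 3 * (q + 1) * (q - 1) * (q / 2) ∧
        (numParabolas q F (q + 1) : ℚ) = q ^ 3 * (q + 1) * (q - 1) * (q / 2 - 1) ∧
        (numParabolas q F (2 * q - 1) : ℚ) = q ^ 3 * (q + 1) * (q / 2)) ∧
      (q = 2 → numParabolas q F 1 = 24 ∧ numParabolas q F 3 = 24)) := by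
  classical
  have : Fintype F := Fintype.ofFinite F
  obtain ⟨σ, hσ⟩ := exists_ringHom_eq_pow hq hF
  rw [Nat.card_eq_fintype_card] at hF
  have hq2 : 2 ≤ q := hq.two_le
  have hq2' : q ≤ q ^ 2 := by nlinarith
  obtain ⟨hsum, hdouble⟩ := card_leading_coeff_classes hq2 hF hσ
  have hnum := two_mul_numParabolas hq2 hF hσ
  have hdisc := card_filter_disc_eq_zero hq2 hF hσ
  set E := #{a : F | a ≠ 0 ∧ 1 - 4 * (a * σ a) ≠ 0 ∧ #(isoDirs σ a) = 0}
  set H := #{a : F | 1 - 4 * (a * σ a) ≠ 0 ∧ #(isoDirs σ a) = 2}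
  set D := #{a : F | 1 - 4 * (a * σ a) = 0} with hD
  constructor
  · intro hodd
    have h2 : (2 : F) ≠ 0 := by
      apply Ring.two_ne_zero
      rw [Ne, FiniteField.even_card_iff_char_two, hF, ← Nat.even_iff, Nat.even_pow]
      exact fun h => (Nat.not_even_iff_odd.2 hodd) h.1
    have hq3 : 3 ≤ q := by
      obtain ⟨m, rfl⟩ := hodd; omega
    rw [hdisc h2] at hsum hdouble hnum
    have hsumQ : (E : ℚ) + H + (q + 1) + 1 = q ^ 2 := by exact_mod_cast hsum
    have hdoubleQ : 2 * (H : ℚ) + (q + 1) = (q + 1) * q := by exact_mod_cast hdouble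
    have hH : (H : ℚ) = (q + 1) * (q - 1) / 2 := by linear_combination hdoubleQ / 2
    have hE : (E : ℚ) = (q + 1) * (q - 3) / 2 := by linear_combination hsumQ - hH
    have hcast1 : ((q - 1 : ℕ) : ℚ) = q - 1 := by push_cast [Nat.cast_sub (by omega : 1 ≤ q)]; rfl
    have hcast2 : ((q ^ 2 - q : ℕ) : ℚ) = q ^ 2 - q := by push_cast [Nat.cast_sub hq2']; rfl
    refine ⟨?_, ?_⟩
    · rintro C ⟨a, b, c, -, rfl⟩
      rw [planarIntersection_parabola hσ]
      simp only [Set.mem_insert_iff, Set.mem_singleton_iff]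
      by_cases ha : 1 - 4 * (a * σ a) = 0
      · have := abscissaCount_mem_of_disc_eq_zero hq2 hF hσ ha b c
        tauto
      · have := abscissaCount_mem_of_disc_ne_zero hq2 hF hσ ha b c
        simp only [Set.mem_insert_iff, Set.mem_singleton_iff] at this
        tauto
    refine ⟨?_, ?_, ?_, ?_, ?_, ?_, ?_⟩
    -- For q ≥ 3 the seven values of k are distinct, so `omega` discards all indicators but one.
    · have h := hnum 0
      simp (disch := omega) only [if_neg, reduceIte] at h
      have h' := congrArg (Nat.cast : ℕ → ℚ) h
      push_cast [hcast1, hcast2, hH, hE] at h'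
      linear_combination h' / 2
    · have h := hnum 1
      simp (disch := omega) only [if_neg, reduceIte] at h
      have h' := congrArg (Nat.cast : ℕ → ℚ) h
      push_cast [hcast1, hcast2, hH, hE] at h'
      linear_combination h' / 2
    · have h := hnum (q - 1)
      simp (disch := omega) only [if_neg, reduceIte] at h
      have h' := congrArg (Nat.cast : ℕ → ℚ) h
      push_cast [hcast1, hcast2, hH, hE] at h'
      linear_combination h' / 2
    · have h := hnum q
      simp (disch := omega) only [if_neg, reduceIte] at h
      have h' := congrArg (Nat.cast : ℕ → ℚ) h
      push_cast [hcast1, hcast2, hH, hE] at h'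
      linear_combination h' / 2
    · have h := hnum (q + 1)
      simp (disch := omega) only [if_neg, reduceIte] at h
      have h' := congrArg (Nat.cast : ℕ → ℚ) h
      push_cast [hcast1, hcast2, hH, hE] at h'
      linear_combination h' / 2
    · have h := hnum (2 * q - 1)
      simp (disch := omega) only [if_neg, reduceIte] at h
      have h' := congrArg (Nat.cast : ℕ → ℚ) h
      push_cast [hcast1, hcast2, hH, hE] at h'
      linear_combination h' / 2
    · have h := hnum (2 * q)
      simp (disch := omega) only [if_neg, reduceIte] at h
      have h' := congrArg (Nat.cast : ℕ → ℚ) h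
      push_cast [hcast1, hcast2, hH, hE] at h'
      linear_combination h' / 2
  · intro heven
    have h2 : (2 : F) = 0 := by
      have hchar : ringChar F = 2 := by
        rw [FiniteField.even_card_iff_char_two, hF, ← Nat.even_iff, Nat.even_pow]
        exact ⟨heven, two_ne_zero⟩
      have := ringChar.Nat.cast_ringChar (R := F)
      rw [hchar] at this
      exact_mod_cast this
    -- In characteristic 2 the discriminant is 1, so no form is degenerate.
    have hdisc' : ∀ a : F, 1 - 4 * (a * σ a) ≠ 0 := by
      intro a
      have : 1 - 4 * (a * σ a) = 1 := by linear_combination -2 * (a * σ a) * h2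
      rw [this]; exact one_ne_zero
    have hD0 : D = 0 := by
      rw [hD, card_eq_zero, filter_eq_empty_iff]
      exact fun a _ => hdisc' a
    rw [hD0] at hsum hdouble hnum
    have hsumQ : (E : ℚ) + H + 0 + 1 = q ^ 2 := by exact_mod_cast hsum
    have hdoubleQ : 2 * (H : ℚ) + 0 = (q + 1) * q := by exact_mod_cast hdouble
    have hH : (H : ℚ) = (q + 1) * q / 2 := by linear_combination hdoubleQ / 2
    have hE : (E : ℚ) = (q + 1) * (q / 2 - 1) := by linear_combination hsumQ - hH
    have hcast2 : ((q ^ 2 - q : ℕ) : ℚ) = q ^ 2 - q := by push_cast [Nat.cast_sub hq2']; rfl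
    refine ⟨?_, ?_, ?_⟩
    · rintro C ⟨a, b, c, -, rfl⟩
      rw [planarIntersection_parabola hσ]
      exact abscissaCount_mem_of_disc_ne_zero hq2 hF hσ (hdisc' a) b c
    · intro hne
      have hq4 : 3 ≤ q := by omega
      have hq3 : q ≠ 3 := by rintro rfl; exact absurd heven (by decide)
      refine ⟨?_, ?_, ?_, ?_⟩
      · have h := hnum 1
        simp (disch := omega) only [if_neg, reduceIte] at h
        have h' := congrArg (Nat.cast : ℕ → ℚ) h
        push_cast [hcast2, hH, hE] at h'
        linear_combination h' / 2
      · have h := hnum (q - 1)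
        simp (disch := omega) only [if_neg, reduceIte] at h
        have h' := congrArg (Nat.cast : ℕ → ℚ) h
        push_cast [hcast2, hH, hE] at h'
        linear_combination h' / 2
      · have h := hnum (q + 1)
        simp (disch := omega) only [if_neg, reduceIte] at h
        have h' := congrArg (Nat.cast : ℕ → ℚ) h
        push_cast [hcast2, hH, hE] at h'
        linear_combination h' / 2
      · have h := hnum (2 * q - 1)
        simp (disch := omega) only [if_neg, reduceIte] at h
        have h' := congrArg (Nat.cast : ℕ → ℚ) h
        push_cast [hcast2, hH, hE] at h'
        linear_combination h' / 2
    · intro hq2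
      -- For q = 2 every a ≠ 0 has two isotropic directions; as q = q² - q = 2, counts 1 and 3 occur
      -- equally often.
      have hH3 : H = 3 := by rw [hq2] at hdouble; omega
      have hE0 : E = 0 := by rw [hq2, hH3] at hsum; omega
      have h1 := hnum 1
      have h3 := hnum 3
      rw [hH3, hE0, hq2] at h1 h3
      norm_num at h1 h3
      rw [hq2]
      omega
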